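/- Let $M$ be a smooth $m$-dimensional manifold, Hausdorff and second countable, possibly with boundary (without corners). Let $k\in\mathbb N$ and $r\in\mathbb N\cup\{\infty\}$, and let $E^r=\mathcal C^r(M,\mathbb R^k)$ carry the weak Whitney topology, i.e. the topology defined by the seminorms $$\|f\|_{Q,s}=\sup\{|\partial_\alpha(f\circ Q)(x)| : \alpha\in\mathbb N^m,\ |\alpha|\le s,\ x\in\operatorname{int}(D)\},$$ where $Q\colon D\hookrightarrow M$ ranges over the smooth embeddings of compact sets $D\subset\mathbb R^m$ and $s$ over the natural numbers $s\le r$. Let $(E^r)^*$ be the space of continuous linear functionals $T\colon E^r\to\mathbb R$, with the weak-$*$ topology (pointwise convergence on $E^r$). Let $\mathbb D^m\subset\mathbb R^m$ be the closed unit disk and let $\mathcal M(\mathbb D^m)$ be the set of finite signed Borel measures on it. 1. Let $\mathcal M^r_{loc}$ be the set of all $T\in(E^r)^*$ of the form $$T(f)=\int_{\mathbb D^m}\partial_\alpha(f^j\circ Q)\,d\mu ,$$ for some smooth embedding $Q\colon\mathbb D^m\hookrightarrow M$, some multi-index $\alpha\in\mathbb N^m$ with $|\alpha|\le r$, some $j\in\{1,\dots,k\}$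 and some $\mu\in\mathcal M(\mathbb D^m)$ (at boundary points of $\mathbb D^m$ the derivatives are those up to the boundary). Then $(E^r)^*=\operatorname{span}\mathcal M^r_{loc}$. 2. For all $p\in M$ and $j\in\{1,\dots,k\}$ the point evaluation $\delta_p^j\colon f\mapsto f^j(p)$ belongs to $(E^r)^*$, and the linear span of $\delta_M=\{\delta_p^j : p\in M,\ 1\le j\le k\}$ is dense in $(E^r)^*$ in the weak-$*$ topology: $(E^r)^*=\overline{\operatorname{span}\,\delta_M}$. -/

import Mathlib

open scoped Manifold ContDiff

noncomputable section

/-- The space `ℝⁿ` with its Euclidean norm. -/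
abbrev Euc (n : ℕ) : Type := EuclideanSpace ℝ (Fin n)

/-- `I` is a model for manifolds of dimension `m`, possibly with boundary (but without corners): its
range is `ℝᵐ` or a half space `{x | 0 ≤ xᵢ}`. Both `𝓡 m` and `𝓡∂ m` are of this kind. -/
def IsBoundaryModel {m : ℕ} {H : Type*} [TopologicalSpace H]
    (I : ModelWithCorners ℝ (Euc m) H) : Prop :=
  Set.range I = Set.univ ∨ ∃ i : Fin m, Set.range I = {x : Euc m | 0 ≤ x i}

/-- The constant vectors along which one differentiates to obtain `∂_α`: the basis vector `eᵢ`
occurs `αᵢ` times. -/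
def multiIndexDirections {m : ℕ} (α : Fin m → ℕ) : Fin (∑ i, α i) → Euc m :=
  fun l => EuclideanSpace.single (finSigmaFinEquiv.symm l).1 1

/-- The partial derivative `∂_α g (x)` of order `|α| = ∑ᵢ αᵢ` of a function `g` on the set `D`. At
interior points of `D` this is the usual derivative, at the boundary points of a closed ball it is
the derivative of `g` up to the boundary. -/
def partialDerivOn {m : ℕ} {F : Type*} [NormedAddCommGroup F] [NormedSpace ℝ F]
    (α : Fin m → ℕ) (g : Euc m → F) (D : Set (Euc m)) (x : Euc m) : F :=
  iteratedFDerivWithin ℝ (∑ i, α i) g D x (multiIndexDirections α)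

section Manifold

variable {m : ℕ} {H : Type*} [TopologicalSpace H] (I : ModelWithCorners ℝ (Euc m) H)
  {M : Type*} [TopologicalSpace M] [ChartedSpace H M]

/-- `Q` restricts to a smooth embedding of `D ⊆ ℝᵐ` in `M`: smooth on `D`, an immersion at each
point of `D`, and a homeomorphism of `D` onto its image. Values of `Q` outside `D` are irrelevant. -/
structure IsEmbeddingOn (Q : Euc m → M) (D : Set (Euc m)) : Prop where
  contMDiffOn : ContMDiffOn 𝓘(ℝ, Euc m) I ∞ Q D
  injective_mfderivWithin :
    ∀ x ∈ D, Function.Injective (mfderivWithin 𝓘(ℝ, Euc m) I Q D x)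
  isEmbedding : Topology.IsEmbedding (D.domRestrict Q)

variable (M) in
/-- An embedding in `M` of a compact subset of `ℝᵐ`. -/
structure CompactEmbedding where
  domain : Set (Euc m)
  toFun : Euc m → M
  isCompact_domain : IsCompact domain
  isEmbeddingOn : IsEmbeddingOn I toFun domain

variable (M) in
/-- The vector space `𝒞ʳ(M, ℝᵏ)`, for `r ∈ ℕ ∪ {∞}`. -/
abbrev CrMap (r : ℕ∞) (k : ℕ) : Type _ :=
  C^(r : WithTop ℕ∞)⟮I, M; 𝓘(ℝ, Euc k), Euc k⟯

end Manifold

section Bounds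

theorem norm_multiIndexDirections {m : ℕ} (α : Fin m → ℕ) (l : Fin (∑ i, α i)) :
    ‖multiIndexDirections α l‖ = 1 := by
  simp [multiIndexDirections]

theorem norm_partialDerivOn_le {m : ℕ} {F : Type*} [NormedAddCommGroup F] [NormedSpace ℝ F]
    (α : Fin m → ℕ) (g : Euc m → F) (D : Set (Euc m)) (x : Euc m) :
    ‖partialDerivOn α g D x‖ ≤ ‖iteratedFDerivWithin ℝ (∑ i, α i) g D x‖ := by
  refine (ContinuousMultilinearMap.le_opNorm _ _).trans ?_
  simp [norm_multiIndexDirections]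

/-- The derivatives of a `Cˢ` function on a compact set are bounded on the interior. -/
theorem exists_bound_iteratedFDerivWithin {E F : Type*} [NormedAddCommGroup E] [NormedSpace ℝ E]
    [NormedAddCommGroup F] [NormedSpace ℝ F] {g : E → F} {D : Set E} {s n : ℕ}
    (hD : IsCompact D) (hg : ContDiffOn ℝ s g D) (hn : n ≤ s) :
    ∃ C : ℝ, ∀ x ∈ interior D, ‖iteratedFDerivWithin ℝ n g D x‖ ≤ C := by
  have key : ∃ C : ℝ, ∀ x ∈ D ∩ interior D, ‖iteratedFDerivWithin ℝ n g D x‖ ≤ C := by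
    refine hD.induction_on
      (p := fun S => ∃ C : ℝ, ∀ x ∈ S ∩ interior D, ‖iteratedFDerivWithin ℝ n g D x‖ ≤ C)
      ⟨0, by simp⟩ ?_ ?_ ?_
    · rintro S T hST ⟨C, hC⟩
      exact ⟨C, fun x hx => hC x ⟨hST hx.1, hx.2⟩⟩
    · rintro S T ⟨C, hC⟩ ⟨C', hC'⟩
      refine ⟨max C C', ?_⟩
      rintro x ⟨hx | hx, hx'⟩
      · exact (hC x ⟨hx, hx'⟩).trans (le_max_left _ _)
      · exact (hC' x ⟨hx, hx'⟩).trans (le_max_right _ _)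
    · intro x hx
      obtain ⟨u, hu, p, hp⟩ := contDiffWithinAt_nat.1 (hg x hx)
      rw [Set.insert_eq_of_mem hx] at hu
      have hxu : x ∈ u := mem_of_mem_nhdsWithin hx hu
      have hcont : ContinuousWithinAt (fun y => ‖p y n‖) u x :=
        ((hp.cont n (by exact_mod_cast hn)) x hxu).norm
      have hlt : ∀ᶠ y in nhdsWithin x u, ‖p y n‖ < ‖p x n‖ + 1 :=
        hcont.eventually (gt_mem_nhds (lt_add_one _))
      have hlt' : ∀ᶠ y in nhdsWithin x D, ‖p y n‖ < ‖p x n‖ + 1 :=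
        nhdsWithin_le_of_mem hu hlt
      obtain ⟨V, hVo, hxV, hV⟩ := mem_nhdsWithin.1 hu
      refine ⟨{y | ‖p y n‖ < ‖p x n‖ + 1} ∩ V,
        Filter.inter_mem hlt' (mem_nhdsWithin_of_mem_nhds (hVo.mem_nhds hxV)), ‖p x n‖ + 1, ?_⟩
      rintro y ⟨⟨hy1, hyV⟩, hyD⟩
      have hopen : IsOpen (V ∩ interior D) := hVo.inter isOpen_interior
      have hp' : HasFTaylorSeriesUpToOn s g p (V ∩ interior D) :=
        hp.mono fun z hz => hV ⟨hz.1, interior_subset hz.2⟩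
      have h1 : p y n = iteratedFDerivWithin ℝ n g (V ∩ interior D) y :=
        hp'.eq_iteratedFDerivWithin_of_uniqueDiffOn (by exact_mod_cast hn)
          hopen.uniqueDiffOn ⟨hyV, hyD⟩
      have h2 : iteratedFDerivWithin ℝ n g (V ∩ interior D) y = iteratedFDerivWithin ℝ n g D y := by
        refine iteratedFDerivWithin_congr_set ?_ n
        filter_upwards [hopen.mem_nhds ⟨hyV, hyD⟩] with z hz
        exact propext ⟨fun _ => interior_subset hz.2, fun _ => hz⟩
      rw [← h2, ← h1]
      exact le_of_lt hy1
  obtain ⟨C, hC⟩ := key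
  exact ⟨C, fun x hx => hC x ⟨interior_subset hx, hx⟩⟩

end Bounds

section Topology

variable {m : ℕ} {H : Type*} [TopologicalSpace H] {I : ModelWithCorners ℝ (Euc m) H}
  {M : Type*} [TopologicalSpace M] [ChartedSpace H M] {r : ℕ∞} {k : ℕ}

theorem CompactEmbedding.contDiffOn_comp (P : CompactEmbedding I M) (f : CrMap I M r k) :
    ContDiffOn ℝ r (f ∘ P.toFun) P.domain := by
  rw [← contMDiffOn_iff_contDiffOn]
  exact f.contMDiff.comp_contMDiffOn
    (P.isEmbeddingOn.contMDiffOn.of_le (by exact_mod_cast (le_top : r ≤ ⊤)))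

/-- The pairs `(α, x)` over which the supremum in `‖f‖_{Q,s}` is taken: `|α| ≤ s` and
`x ∈ int D`. -/
abbrev CompactEmbedding.Range (P : CompactEmbedding I M) (s : ℕ) : Type :=
  {α : Fin m → ℕ // ∑ i, α i ≤ s} × interior P.domain

theorem CompactEmbedding.bddAbove (P : CompactEmbedding I M) {s : ℕ} (hs : (s : ℕ∞) ≤ r)
    (f : CrMap I M r k) :
    BddAbove (Set.range fun a : P.Range s =>
      ‖partialDerivOn a.1.1 (f ∘ P.toFun) P.domain a.2‖) := by
  have hg : ContDiffOn ℝ s (f ∘ P.toFun) P.domain :=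
    (P.contDiffOn_comp f).of_le (by exact_mod_cast hs)
  have h : ∀ n : ℕ, ∃ C : ℝ, n ≤ s → ∀ x ∈ interior P.domain,
      ‖iteratedFDerivWithin ℝ n (f ∘ P.toFun) P.domain x‖ ≤ C := by
    intro n
    by_cases hn : n ≤ s
    · obtain ⟨C, hC⟩ := exists_bound_iteratedFDerivWithin P.isCompact_domain hg hn
      exact ⟨C, fun _ => hC⟩
    · exact ⟨0, fun h => absurd h hn⟩
  choose C hC using h
  refine ⟨∑ n ∈ Finset.range (s + 1), |C n|, ?_⟩
  rintro _ ⟨⟨⟨α, hα⟩, x⟩, rfl⟩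
  calc ‖partialDerivOn α (f ∘ P.toFun) P.domain x‖
      ≤ C (∑ i, α i) := (norm_partialDerivOn_le _ _ _ _).trans (hC _ hα x x.2)
    _ ≤ |C (∑ i, α i)| := le_abs_self _
    _ ≤ ∑ n ∈ Finset.range (s + 1), |C n| :=
      Finset.single_le_sum (f := fun n => |C n|) (fun _ _ => abs_nonneg _)
        (Finset.mem_range.2 (Nat.lt_succ_of_le hα))

theorem partialDerivOn_add_interior {F : Type*} [NormedAddCommGroup F] [NormedSpace ℝ F]
    {α : Fin m → ℕ} {f g : Euc m → F} {D : Set (Euc m)} {x : Euc m} (hx : x ∈ interior D)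
    (hf : ContDiffOn ℝ (∑ i, α i : ℕ) f D) (hg : ContDiffOn ℝ (∑ i, α i : ℕ) g D) :
    partialDerivOn α (f + g) D x = partialDerivOn α f D x + partialDerivOn α g D x := by
  have hset : D =ᶠ[nhds x] interior D := by
    filter_upwards [isOpen_interior.mem_nhds hx] with z hz
    exact propext ⟨fun _ => hz, fun _ => interior_subset hz⟩
  simp only [partialDerivOn, iteratedFDerivWithin_congr_set hset]
  rw [iteratedFDerivWithin_add_apply ((hf.mono interior_subset) x hx)
    ((hg.mono interior_subset) x hx) isOpen_interior.uniqueDiffOn hx]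
  rfl

theorem partialDerivOn_smul_interior {F : Type*} [NormedAddCommGroup F] [NormedSpace ℝ F]
    {α : Fin m → ℕ} {f : Euc m → F} {D : Set (Euc m)} {x : Euc m} (hx : x ∈ interior D) (c : ℝ)
    (hf : ContDiffOn ℝ (∑ i, α i : ℕ) f D) :
    partialDerivOn α (c • f) D x = c • partialDerivOn α f D x := by
  have hset : D =ᶠ[nhds x] interior D := by
    filter_upwards [isOpen_interior.mem_nhds hx] with z hz
    exact propext ⟨fun _ => hz, fun _ => interior_subset hz⟩
  simp only [partialDerivOn, iteratedFDerivWithin_congr_set hset]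
  rw [iteratedFDerivWithin_const_smul_apply ((hf.mono interior_subset) x hx)
    isOpen_interior.uniqueDiffOn hx]
  rfl

/-- The seminorm
`‖f‖_{Q,s} = sup {|∂_α (f ∘ Q) (x)| : α ∈ ℕᵐ, |α| ≤ s, x ∈ int D}` on `𝒞ʳ(M, ℝᵏ)`, for an embedding
`Q` of a compact set `D ⊆ ℝᵐ` and a natural number `s ≤ r`. -/
def weakSeminorm (P : CompactEmbedding I M) (s : ℕ) (hs : (s : ℕ∞) ≤ r) :
    Seminorm ℝ (CrMap I M r k) :=
  Seminorm.of
    (fun f => ⨆ a : P.Range s, ‖partialDerivOn a.1.1 (f ∘ P.toFun) P.domain a.2‖)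
    (fun f g => by
      have hC : ∀ f : CrMap I M r k, ∀ α : Fin m → ℕ, ∑ i, α i ≤ s →
          ContDiffOn ℝ (∑ i, α i : ℕ) (f ∘ P.toFun) P.domain := fun f α hα =>
        (P.contDiffOn_comp f).of_le
          (by exact_mod_cast (Nat.cast_le.2 hα : ((∑ i, α i : ℕ) : ℕ∞) ≤ s).trans hs)
      refine Real.iSup_le (fun a => ?_)
        (add_nonneg (Real.iSup_nonneg fun _ => norm_nonneg _)
          (Real.iSup_nonneg fun _ => norm_nonneg _))
      have h : partialDerivOn a.1.1 ((f + g : CrMap I M r k) ∘ P.toFun) P.domain a.2 =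
          partialDerivOn a.1.1 (f ∘ P.toFun) P.domain a.2 +
            partialDerivOn a.1.1 (g ∘ P.toFun) P.domain a.2 :=
        partialDerivOn_add_interior a.2.2 (hC f _ a.1.2) (hC g _ a.1.2)
      rw [h]
      exact (norm_add_le _ _).trans
        (add_le_add (le_ciSup (P.bddAbove hs f) a) (le_ciSup (P.bddAbove hs g) a)))
    (fun c f => by
      rw [Real.mul_iSup_of_nonneg (norm_nonneg c)]
      refine iSup_congr fun a => ?_
      have h : partialDerivOn a.1.1 ((c • f : CrMap I M r k) ∘ P.toFun) P.domain a.2 =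
          c • partialDerivOn a.1.1 (f ∘ P.toFun) P.domain a.2 :=
        partialDerivOn_smul_interior a.2.2 c ((P.contDiffOn_comp f).of_le
          (by exact_mod_cast (Nat.cast_le.2 a.1.2 : ((∑ i, a.1.1 i : ℕ) : ℕ∞) ≤ s).trans hs))
      rw [h, norm_smul])

/-- The weak Whitney topology on `𝒞ʳ(M, ℝᵏ)`: the topology defined by the seminorms `‖·‖_{Q,s}`,
for all embeddings `Q` of compact subsets of `ℝᵐ` and all finite `s ≤ r`. -/
instance weakWhitneyTopology : TopologicalSpace (CrMap I M r k) :=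
  ⨅ (P : CompactEmbedding I M) (s : {s : ℕ // (s : ℕ∞) ≤ r}),
    (weakSeminorm (k := k) P s.1 s.2).toSeminormedAddCommGroup.toUniformSpace.toTopologicalSpace

end Topology

section Dual

variable {m : ℕ} {H : Type*} [TopologicalSpace H] (I : ModelWithCorners ℝ (Euc m) H)
  (M : Type*) [TopologicalSpace M] [ChartedSpace H M] (r : ℕ∞) (k : ℕ)

/-- The closed unit disk `𝔻ᵐ ⊆ ℝᵐ`. -/
abbrev unitDisk (m : ℕ) : Set (Euc m) := Metric.closedBall 0 1

/-- The topological dual of `𝒞ʳ(M, ℝᵏ)`, with the weak-* topology. -/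
abbrev CrDual : Type _ := WeakDual ℝ (CrMap I M r k)

/-- The set of the continuous linear functionals on `𝒞ʳ(M, ℝᵏ)` of the form
`T(f) = ∫_{𝔻ᵐ} ∂_α (fʲ ∘ Q) dμ`, for some embedding `Q` of the disk `𝔻ᵐ` in `M`, some multi-index `α`
with `|α| ≤ r`, some `j` and some finite signed Borel measure `μ` on `𝔻ᵐ`. -/
def localFunctionals : Set (CrDual I M r k) :=
  {T | ∃ (Q : Euc m → M) (α : Fin m → ℕ) (j : Fin k) (μ : MeasureTheory.SignedMeasure (unitDisk m)),
    IsEmbeddingOn I Q (unitDisk m) ∧ ((∑ i, α i : ℕ) : ℕ∞) ≤ r ∧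
    ∀ f : CrMap I M r k,
      T f = ∫ᵛ u, partialDerivOn α (fun x => f (Q x) j) (unitDisk m) u ∂<•μ}

/-- The set `δ_M` of the continuous linear functionals `f ↦ fʲ(p)`, with `p ∈ M` and
`j ∈ {1, …, k}`. -/
def pointEvaluations : Set (CrDual I M r k) :=
  {T | ∃ (p : M) (j : Fin k), ∀ f : CrMap I M r k, T f = f p j}

end Dual

end

/-! A continuous functional `T` is bounded by finitely many seminorms, and embeddings of the unit
disk suffice to give them. Around each point, also a boundary point, there is an embedded disk with
a smooth coordinate `R` on a neighbourhood (`exists_diskChart`). On a small piece of a compact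
domain, `f ∘ P = (f ∘ Q) ∘ (R ∘ P)`, so a Faà di Bruno estimate bounds the derivatives of `f ∘ P` by
those of `f ∘ Q`; compactness leaves finitely many disks.

Hence `|T f|` is bounded by a multiple of a finite sum of sup norms of functions `∂_α (fʲ ∘ Q)` on
the closed disk. By Hahn–Banach, `T` is a sum of continuous functionals on `C(𝔻ᵐ)` applied to these
functions (`exists_eq_sum_comp_of_le`), and Riesz–Markov–Kakutani turns each of them into a signed
measure. This gives the span statement.

For density, every weak-* continuous functional on the dual is evaluation at some `f`. If it kills
all `δ_p^j`, then `f = 0`, so Hahn–Banach leaves nothing outside the closure. -/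

/-! ### Riesz representation, factorization of functionals, weak-* density -/

section FunctionalAnalysis

open MeasureTheory

open scoped CompactlySupported in
/-- The **Riesz-Markov-Kakutani theorem** for continuous functionals on `C(X, ℝ)`, `X` compact. -/
theorem exists_signedMeasure_integral_eq {X : Type*} [TopologicalSpace X] [CompactSpace X]
    [T2Space X] [MeasurableSpace X] [BorelSpace X] (l : C(X, ℝ) →L[ℝ] ℝ) :
    ∃ μ : SignedMeasure X, ∀ f : C(X, ℝ), l f = ∫ᵛ x, f x ∂<•μ := by
  rcases isEmpty_or_nonempty X with hX | ⟨⟨x₀⟩⟩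
  · refine ⟨0, fun f => ?_⟩
    have hf : f = 0 := ContinuousMap.ext fun x => isEmptyElim x
    simp [hf]
  let s : PointedCone ℝ (C(X, ℝ) × C(X, ℝ)) := PointedCone.positive ℝ _
  -- Pairs `(a, b)` with `a + b` constant; evaluation at `x₀` reads off the constant. For `a, b ≥ 0`
  -- it bounds `‖a - b‖`, so `L` is positive on `p` and has a positive extension `g`. The two
  -- restrictions of `g` are measures `μ` and `ν`. As `(f, -f)` lies in `p` with sum zero, `μ f - ν
  -- f = L (f, -f) = 2 l f`.
  let p : Submodule ℝ (C(X, ℝ) × C(X, ℝ)) :=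
    { carrier := {a | ∀ x, a.1 x + a.2 x = a.1 x₀ + a.2 x₀}
      zero_mem' := by simp
      add_mem' := fun {a b} ha hb x => by
        have h1 := ha x
        have h2 := hb x
        simp only [Prod.fst_add, Prod.snd_add, ContinuousMap.add_apply]
        linarith
      smul_mem' := fun c a ha x => by
        have h1 := ha x
        simp only [Prod.smul_fst, Prod.smul_snd, ContinuousMap.smul_apply, smul_eq_mul, ← mul_add,
          h1] }
  let L : (C(X, ℝ) × C(X, ℝ)) →ₗ[ℝ] ℝ :=
    { toFun := fun a => ‖l‖ * (a.1 x₀ + a.2 x₀) + l (a.1 - a.2)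
      map_add' := fun a b => by simp; ring
      map_smul' := fun c a => by simp; ring }
  have hL : ∀ a, L a = ‖l‖ * (a.1 x₀ + a.2 x₀) + l (a.1 - a.2) := fun _ => rfl
  obtain ⟨g, hgL, hg⟩ := riesz_extension s ⟨p, L.domRestrict p⟩ (by
    rintro ⟨a, hap⟩ ha
    obtain ⟨h1, h2⟩ : 0 ≤ a.1 ∧ 0 ≤ a.2 := ((PointedCone.mem_positive ℝ _).1 ha)
    change 0 ≤ L a
    have hn : ‖a.1 - a.2‖ ≤ a.1 x₀ + a.2 x₀ := by
      refine (ContinuousMap.norm_le _ (add_nonneg (h1 x₀) (h2 x₀))).2 fun x => ?_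
      have h3 : 0 ≤ a.1 x := h1 x
      have h4 : 0 ≤ a.2 x := h2 x
      refine le_of_le_of_eq ?_ (hap x)
      rw [ContinuousMap.sub_apply, Real.norm_eq_abs, abs_le]
      constructor <;> linarith
    have h5 := (abs_le.1 ((l.le_opNorm (a.1 - a.2)).trans
      (mul_le_mul_of_nonneg_left hn (norm_nonneg l)))).1
    rw [hL]
    linarith) (by
    rintro ⟨a, b⟩
    -- Cofinality for the extension theorem: a large constant pair, which lies in `p`, makes any
    -- pair nonnegative.
    let M : C(X, ℝ) := ContinuousMap.const X (‖a‖ + ‖b‖)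
    refine ⟨⟨(M, M), fun x => rfl⟩, (PointedCone.mem_positive ℝ _).2 ⟨fun x => ?_, fun x => ?_⟩⟩
    · have := (abs_le.1 (a.norm_coe_le_norm x)).1
      have := norm_nonneg b
      change 0 ≤ ‖a‖ + ‖b‖ + a x
      linarith
    · have := (abs_le.1 (b.norm_coe_le_norm x)).1
      have := norm_nonneg a
      change 0 ≤ ‖a‖ + ‖b‖ + b x
      linarith)
  have key : ∀ h : C(X, ℝ) →ₗ[ℝ] ℝ, (∀ f, 0 ≤ f → 0 ≤ h f) →
      ∃ μ : Measure X, IsFiniteMeasure μ ∧ ∀ f : C(X, ℝ), h f = ∫ x, f x ∂μ := by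
    intro h hh
    let Λ : C_c(X, ℝ) →ₚ[ℝ] ℝ := PositiveLinearMap.mk₀
      { toFun := fun f => h f.toContinuousMap
        map_add' := fun f f' => h.map_add f.toContinuousMap f'.toContinuousMap
        map_smul' := fun c f => h.map_smul c f.toContinuousMap } (fun f hf => hh _ hf)
    refine ⟨RealRMK.rieszMeasure Λ, inferInstance, fun f => ?_⟩
    exact (RealRMK.integral_rieszMeasure Λ ⟨f, HasCompactSupport.of_compactSpace _⟩).symm
  obtain ⟨μ, _, hμ⟩ := key (g ∘ₗ LinearMap.inl ℝ _ _)
    (fun f hf => hg _ ((PointedCone.mem_positive ℝ _).2 ⟨hf, le_rfl⟩))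
  obtain ⟨ν, _, hν⟩ := key (g ∘ₗ LinearMap.inr ℝ _ _)
    (fun f hf => hg _ ((PointedCone.mem_positive ℝ _).2 ⟨le_rfl, hf⟩))
  have hint : ∀ (μ : Measure X) [IsFiniteMeasure μ] (f : C(X, ℝ)),
      μ.toSignedMeasure.Integrable f := fun μ _ f => by
    simpa [VectorMeasure.Integrable] using
      f.continuous.integrable_of_hasCompactSupport (μ := μ) (HasCompactSupport.of_compactSpace _)
  refine ⟨(2⁻¹ : ℝ) • (μ.toSignedMeasure - ν.toSignedMeasure), fun f => ?_⟩
  have h1 : g (f, -f) = l (f + f) := by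
    have := hgL ⟨(f, -f), fun x => by simp⟩
    rw [this]
    change L (f, -f) = _
    simp [hL]
  have h2 : g (f, -f) = ∫ x, f x ∂μ - ∫ x, f x ∂ν := by
    rw [← hμ, ← hν, LinearMap.comp_apply, LinearMap.comp_apply, ← map_sub]
    simp
  rw [VectorMeasure.integral_smul_vectorMeasure,
    VectorMeasure.integral_sub_vectorMeasure (hint μ f) (hint ν f),
    VectorMeasure.integral_toSignedMeasure, VectorMeasure.integral_toSignedMeasure, ← h2, h1,
    map_add, smul_eq_mul]
  ring

/-- A functional dominated by finitely many linear maps to normed spaces is a sum of continuous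
functionals composed with these maps. -/
theorem exists_eq_sum_comp_of_le {E ι : Type*} [AddCommGroup E] [Module ℝ E] [Fintype ι]
    {F : Type*} [NormedAddCommGroup F] [NormedSpace ℝ F]
    (J : ι → E →ₗ[ℝ] F) (T : E →ₗ[ℝ] ℝ) {C : ℝ} (hT : ∀ f, ‖T f‖ ≤ C * ∑ i, ‖J i f‖) :
    ∃ l : ι → F →L[ℝ] ℝ, ∀ f, T f = ∑ i, l i (J i f) := by
  classical
  let K : E →ₗ[ℝ] (ι → F) := LinearMap.pi J
  -- The bound makes `T` vanish on the kernel of `K`, so `T ∘ σ` does not depend on the section `σ`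
  -- and is the bounded functional induced by `T` on the range. Hahn–Banach extends it to the
  -- product, where it splits by coordinates.
  obtain ⟨σ, hσ⟩ := K.rangeRestrict.exists_rightInverse_of_surjective (LinearMap.range_rangeRestrict K)
  have hσ' : ∀ v : K.range, K (σ v) = v := fun v =>
    congrArg Subtype.val (LinearMap.congr_fun hσ v)
  have hT' : ∀ f, ‖T f‖ ≤ |C| * Fintype.card ι * ‖K f‖ := fun f => by
    refine (hT f).trans ?_
    rw [mul_assoc]
    refine mul_le_mul (le_abs_self C) ?_ (by positivity) (abs_nonneg C)
    refine (Finset.sum_le_card_nsmul _ _ ‖K f‖ fun i _ => norm_le_pi_norm (K f) i).trans ?_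
    simp
  let g : K.range →L[ℝ] ℝ := (T ∘ₗ σ).mkContinuous (|C| * Fintype.card ι) fun v => by
    have := hT' (σ v)
    rwa [hσ'] at this
  have hg : ∀ f, T f = g (K.rangeRestrict f) := fun f => by
    have h1 : K (f - σ (K.rangeRestrict f)) = 0 := by
      rw [map_sub, hσ']
      simp
    have h2 := hT' (f - σ (K.rangeRestrict f))
    rw [h1, norm_zero, mul_zero] at h2
    have h3 := norm_le_zero_iff.1 h2
    rw [map_sub, sub_eq_zero] at h3
    exact h3
  obtain ⟨G, hG, -⟩ := _root_.exists_extension_norm_eq K.range g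
  refine ⟨fun i => G ∘L ContinuousLinearMap.single ℝ (fun _ => F) i, fun f => ?_⟩
  have h4 : G (K f) = T f := by
    rw [hg f]
    exact hG (K.rangeRestrict f)
  rw [← h4]
  have h5 : K f = ∑ i, Pi.single i (J i f) := by
    rw [Finset.univ_sum_single fun i => J i f]
    rfl
  rw [h5, map_sum]
  rfl

/-- A set of functionals that separates points spans a weak-* dense subspace. -/
theorem closure_span_eq_univ_of_separating {E : Type*} [AddCommGroup E] [Module ℝ E]
    [TopologicalSpace E] (S : Set (WeakDual ℝ E))
    (hS : ∀ f : E, (∀ φ ∈ S, φ f = 0) → f = 0) :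
    closure (Submodule.span ℝ S : Set (WeakDual ℝ E)) = Set.univ := by
  rw [Set.eq_univ_iff_forall]
  by_contra! h
  obtain ⟨T, hT⟩ := h
  have : LocallyConvexSpace ℝ (WeakDual ℝ E) :=
    inferInstanceAs (LocallyConvexSpace ℝ (WeakBilin (topDualPairing ℝ E)))
  obtain ⟨F, u, hF, hu⟩ := geometric_hahn_banach_closed_point (E := WeakDual ℝ E)
    (Submodule.span ℝ S).convex.closure isClosed_closure hT
  obtain ⟨e, he⟩ := LinearMap.dualEmbedding_surjective (topDualPairing ℝ E) F
  have hFe : ∀ φ : WeakDual ℝ E, F φ = φ e := fun φ => by rw [← he]; rfl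
  have h0 : 0 < u := by simpa using hF 0 (subset_closure (Submodule.zero_mem _))
  have he0 : e = 0 := hS e fun φ hφ => by
    rw [← hFe]
    by_contra hne
    -- A functional bounded above on a subspace vanishes there: the rescaled vector would take the
    -- excluded value `u` itself.
    have := hF ((u / F φ) • φ) (subset_closure (Submodule.smul_mem _ _ (Submodule.subset_span hφ)))
    rw [map_smul, smul_eq_mul, div_mul_cancel₀ _ hne] at this
    exact lt_irrefl _ this
  rw [hFe, he0, map_zero] at hu
  exact lt_asymm h0 hu

end FunctionalAnalysis

/-! ### Symmetry of higher derivatives under finite smoothness -/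

section SymmetricDerivatives

variable {E F : Type*} [NormedAddCommGroup E] [NormedSpace ℝ E]
  [NormedAddCommGroup F] [NormedSpace ℝ F]

theorem fderiv_clm_comp_apply {G : Type*} [NormedAddCommGroup G] [NormedSpace ℝ G] (L : G →L[ℝ] F)
    {φ : E → E →L[ℝ] G} {x : E} (hφ : DifferentiableAt ℝ φ x) (a e : E) :
    fderiv ℝ (fun y => L (φ y a)) x e = L (fderiv ℝ φ x e a) :=
  congrArg (fun A : E →L[ℝ] F => A e)
    ((L ∘L ContinuousLinearMap.apply ℝ G a).hasFDerivAt.comp x hφ.hasFDerivAt).fderiv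

theorem fderiv_iteratedFDeriv_apply {n : ℕ} {f : E → F} {x : E} (hf : ContDiffAt ℝ (n + 1 : ℕ) f x)
    (w : Fin n → E) (e : E) :
    fderiv ℝ (fun y => iteratedFDeriv ℝ n f y w) x e = fderiv ℝ (iteratedFDeriv ℝ n f) x e w := by
  have hd : DifferentiableAt ℝ (iteratedFDeriv ℝ n f) x :=
    (hf.iteratedFDeriv_right (m := 1) (by norm_cast; omega)).differentiableAt one_ne_zero
  have h := ((ContinuousMultilinearMap.apply ℝ (fun _ : Fin n => E) F w).hasFDerivAt.comp x
    hd.hasFDerivAt).fderiv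
  exact congrArg (fun L : E →L[ℝ] F => L e) h

/-- By induction on the order. Exchanging the first two slots is the symmetry of the second
derivative of a lower iterated derivative. Any other adjacent swap leaves the first slot alone, and
follows by differentiating the induction hypothesis, which holds at all nearby points. -/
theorem iteratedFDeriv_comp_swap {n : ℕ} : ∀ {f : E → F} {x : E},
    ContDiffAt ℝ (n + 1 : ℕ) f x → ∀ (v : Fin (n + 1) → E) (i : Fin n),
    iteratedFDeriv ℝ (n + 1) f x (v ∘ Equiv.swap i.castSucc i.succ) =
      iteratedFDeriv ℝ (n + 1) f x v := by
  induction n with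
  | zero => exact fun _ _ i => i.elim0
  | succ n ih =>
    intro f x hf v i
    rw [iteratedFDeriv_succ_apply_left, iteratedFDeriv_succ_apply_left,
      ← fderiv_iteratedFDeriv_apply hf, ← fderiv_iteratedFDeriv_apply hf]
    refine Fin.cases ?_ (fun j => ?_) i
    · have hg : ContDiffAt ℝ 2 (iteratedFDeriv ℝ n f) x :=
        hf.iteratedFDeriv_right (by norm_cast; omega)
      have hd : DifferentiableAt ℝ (fderiv ℝ (iteratedFDeriv ℝ n f)) x :=
        (hg.fderiv_right (m := 1) (by norm_num)).differentiableAt one_ne_zero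
      have hsymm := hg.isSymmSndFDerivAt (by simp)
      have key : ∀ (w : Fin (n + 1) → E) (e : E),
          fderiv ℝ (fun y => iteratedFDeriv ℝ (n + 1) f y w) x e =
            fderiv ℝ (fderiv ℝ (iteratedFDeriv ℝ n f)) x e (w 0) (Fin.tail w) := by
        intro w e
        simp only [iteratedFDeriv_succ_apply_left]
        exact fderiv_clm_comp_apply
          (ContinuousMultilinearMap.apply ℝ (fun _ : Fin n => E) F (Fin.tail w)) hd (w 0) e
      rw [key, key]
      have h1 : Fin.tail (Fin.tail (v ∘ Equiv.swap (Fin.castSucc 0) (Fin.succ 0))) =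
          Fin.tail (Fin.tail v) := by
        funext l
        simp only [Fin.tail, Function.comp_apply]
        rw [Equiv.swap_apply_of_ne_of_ne]
        · simp
        · simp [Fin.ext_iff]
      have h2 : (v ∘ Equiv.swap (Fin.castSucc 0) (Fin.succ 0)) 0 = Fin.tail v 0 := by
        simp [Fin.tail]
      have h3 : Fin.tail (v ∘ Equiv.swap (Fin.castSucc 0) (Fin.succ 0)) 0 = v 0 := by
        simp [Fin.tail]
      rw [h1, h2, h3, hsymm]
    · have h1 : (v ∘ Equiv.swap j.succ.castSucc j.succ.succ) 0 = v 0 := by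
        simp only [Function.comp_apply]
        rw [Equiv.swap_apply_of_ne_of_ne] <;> simp [Fin.ext_iff]
      have h2 : Fin.tail (v ∘ Equiv.swap j.succ.castSucc j.succ.succ) =
          Fin.tail v ∘ Equiv.swap j.castSucc j.succ := by
        funext l
        simp only [Fin.tail, Function.comp_apply, ← Fin.succ_castSucc]
        rw [(Fin.succ_injective _).map_swap]
      rw [h1, h2]
      congr 1
      refine Filter.EventuallyEq.fderiv_eq ?_
      filter_upwards [(hf.of_le (by norm_cast; omega : ((n + 1 : ℕ) : WithTop ℕ∞) ≤ (n + 1 + 1 : ℕ))).eventually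
        (by simp)] with y hy
      exact ih hy _ _

/-- The `n`-th derivative of a `Cⁿ` function is symmetric. -/
theorem ContDiffAt.iteratedFDeriv_comp_perm_of_le {n : ℕ} {f : E → F} {x : E}
    (hf : ContDiffAt ℝ n f x) (v : Fin n → E) (σ : Equiv.Perm (Fin n)) :
    iteratedFDeriv ℝ n f x (v ∘ σ) = iteratedFDeriv ℝ n f x v := by
  cases n with
  | zero => exact congrArg _ (funext fun i => i.elim0)
  | succ n =>
    -- Adjacent transpositions generate the symmetric group.
    have hσ : σ ∈ Submonoid.closure
        (Set.range fun i : Fin n => Equiv.swap i.castSucc i.succ) := by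
      rw [Equiv.Perm.mclosure_swap_castSucc_succ]
      trivial
    induction hσ using Submonoid.closure_induction generalizing v with
    | mem _ h =>
      obtain ⟨i, rfl⟩ := h
      exact iteratedFDeriv_comp_swap hf v i
    | one => rfl
    | mul σ τ _ _ h h' => rw [← h v, ← h' (v ∘ σ)]; rfl

end SymmetricDerivatives

/-! ### Partial derivatives against full derivatives, up to the boundary of the disk -/

section PartialDerivatives

variable {m : ℕ} {F : Type*} [NormedAddCommGroup F] [NormedSpace ℝ F]

/-- Expanding every argument in the standard basis gives `m ^ n` terms, with coefficients at most `∏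
‖v l‖`. -/
theorem norm_le_of_forall_single {n : ℕ} (A : ContinuousMultilinearMap ℝ (fun _ : Fin n => Euc m) F)
    {B : ℝ} (hA : ∀ i : Fin n → Fin m, ‖A fun l => EuclideanSpace.single (i l) 1‖ ≤ B)
    (hB : 0 ≤ B) : ‖A‖ ≤ m ^ n * B := by
  refine A.opNorm_le_bound (by positivity) fun v => ?_
  have hv : ∀ w : Euc m, w = ∑ j, w j • EuclideanSpace.single j (1 : ℝ) := fun w => by
    simpa using ((EuclideanSpace.basisFun (Fin m) ℝ).sum_repr w).symm
  have h1 : A v = ∑ i : Fin n → Fin m,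
      (∏ l, v l (i l)) • A fun l => EuclideanSpace.single (i l) 1 := by
    conv_lhs => rw [funext fun l => hv (v l)]
    rw [A.map_sum]
    exact Finset.sum_congr rfl fun i _ => A.map_smul_univ _ _
  rw [h1]
  refine (norm_sum_le_of_le _ (f := fun i : Fin n → Fin m =>
    (∏ l, v l (i l)) • A fun l => EuclideanSpace.single (i l) 1)
    (n := fun _ => (∏ l, ‖v l‖) * B) fun i _ => ?_).trans (le_of_eq ?_)
  · rw [norm_smul, norm_prod]
    refine mul_le_mul ?_ (hA i) (norm_nonneg _) (by positivity)
    exact Finset.prod_le_prod (fun _ _ => norm_nonneg _) fun l _ => PiLp.norm_apply_le _ _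
  · simp
    ring

/-- `α j` counts how often `j` occurs in `i`; sorting the positions by the fibres of `i` gives the
permutation `e`. -/
theorem exists_multiIndexDirections_comp {n : ℕ} (i : Fin n → Fin m) :
    ∃ α : Fin m → ℕ, n = ∑ j, α j ∧ ∃ e : Fin n ≃ Fin (∑ j, α j),
      (fun l => EuclideanSpace.single (i l) 1) = multiIndexDirections α ∘ e := by
  classical
  let α : Fin m → ℕ := fun j => Fintype.card {l // i l = j}
  let e : Fin n ≃ Fin (∑ j, α j) := (Equiv.sigmaFiberEquiv i).symm.trans
    ((Equiv.sigmaCongrRight fun j => Fintype.equivFin {l // i l = j}).trans finSigmaFinEquiv)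
  refine ⟨α, by simpa using Fintype.card_congr e, e, funext fun l => ?_⟩
  simp [multiIndexDirections, e]

/-- At interior points the derivative within `D` is the ordinary one, so symmetry allows the
directions to be sorted into a multi-index. -/
theorem exists_partialDerivOn_eq {n : ℕ} (i : Fin n → Fin m) :
    ∃ α : Fin m → ℕ, ∑ j, α j = n ∧ ∀ (g : Euc m → F) (D : Set (Euc m)) (x : Euc m),
      x ∈ interior D → ContDiffOn ℝ n g D →
      iteratedFDerivWithin ℝ n g D x (fun l => EuclideanSpace.single (i l) 1) =
        partialDerivOn α g D x := by
  obtain ⟨α, hα, e, he⟩ := exists_multiIndexDirections_comp i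
  refine ⟨α, hα.symm, fun g D x hx hg => ?_⟩
  rw [he]
  subst hα
  have hD : D ∈ nhds x := mem_interior_iff_mem_nhds.1 hx
  have hset : D =ᶠ[nhds x] Set.univ := by
    filter_upwards [hD] with z hz
    exact propext ⟨fun _ => trivial, fun _ => hz⟩
  rw [partialDerivOn, iteratedFDerivWithin_congr_set hset, iteratedFDerivWithin_univ]
  exact (hg.contDiffAt hD).iteratedFDeriv_comp_perm_of_le _ e

theorem uniqueDiffOn_unitDisk : UniqueDiffOn ℝ (unitDisk m) :=
  uniqueDiffOn_convex (convex_closedBall _ _)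
    ⟨0, Metric.ball_subset_interior_closedBall (Metric.mem_ball_self one_pos)⟩

theorem closure_interior_unitDisk : closure (interior (unitDisk m)) = unitDisk m := by
  rw [(convex_closedBall _ _).closure_interior_eq_closure_of_nonempty_interior
    ⟨0, Metric.ball_subset_interior_closedBall (Metric.mem_ball_self one_pos)⟩,
    Metric.isClosed_closedBall.closure_eq]

/-- A bound that holds on the interior of the disk for a continuous function holds on the disk. -/
theorem norm_le_on_unitDisk {G : Type*} [NormedAddCommGroup G] {h : Euc m → G} {B : ℝ}
    (hc : ContinuousOn h (unitDisk m)) (hB : ∀ x ∈ interior (unitDisk m), ‖h x‖ ≤ B) :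
    ∀ x ∈ unitDisk m, ‖h x‖ ≤ B := by
  intro x hx
  have hcl : IsClosed (unitDisk m ∩ (fun x => ‖h x‖) ⁻¹' Set.Iic B) :=
    hc.norm.preimage_isClosed_of_isClosed Metric.isClosed_closedBall isClosed_Iic
  have hsub : interior (unitDisk m) ⊆ unitDisk m ∩ (fun x => ‖h x‖) ⁻¹' Set.Iic B :=
    fun y hy => ⟨interior_subset hy, hB y hy⟩
  have := closure_minimal hsub hcl
  rw [closure_interior_unitDisk] at this
  exact (this hx).2

/-- The seminorms only see partial derivatives at interior points. Basis expansion recovers the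
whole derivative there, and continuity carries the bound to the bounding sphere. -/
theorem norm_iteratedFDerivWithin_unitDisk_le {s n : ℕ} (hn : n ≤ s) {g : Euc m → F} {B : ℝ}
    (hg : ContDiffOn ℝ s g (unitDisk m)) (hB0 : 0 ≤ B)
    (hB : ∀ α : Fin m → ℕ, ∑ i, α i ≤ s → ∀ x ∈ interior (unitDisk m),
      ‖partialDerivOn α g (unitDisk m) x‖ ≤ B) :
    ∀ x ∈ unitDisk m, ‖iteratedFDerivWithin ℝ n g (unitDisk m) x‖ ≤ m ^ n * B := by
  refine norm_le_on_unitDisk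
    (hg.continuousOn_iteratedFDerivWithin (by exact_mod_cast hn) uniqueDiffOn_unitDisk)
    fun x hx => norm_le_of_forall_single _ (fun i => ?_) hB0
  obtain ⟨α, hα, h⟩ := exists_partialDerivOn_eq (F := F) i
  rw [h g _ x hx (hg.of_le (by exact_mod_cast hn))]
  exact hB α (hα.trans_le hn) x hx

theorem continuousOn_partialDerivOn {g : Euc m → F} {α : Fin m → ℕ}
    (hg : ContDiffOn ℝ (∑ i, α i : ℕ) g (unitDisk m)) :
    ContinuousOn (partialDerivOn α g (unitDisk m)) (unitDisk m) :=
  (ContinuousMultilinearMap.apply ℝ (fun _ => Euc m) F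
    (multiIndexDirections α)).continuous.comp_continuousOn
    (hg.continuousOn_iteratedFDerivWithin le_rfl uniqueDiffOn_unitDisk)

theorem partialDerivOn_coord {k : ℕ} {g : Euc m → Euc k} {α : Fin m → ℕ} {x : Euc m}
    (hg : ContDiffOn ℝ (∑ i, α i : ℕ) g (unitDisk m)) (hx : x ∈ unitDisk m) (j : Fin k) :
    partialDerivOn α (fun y => g y j) (unitDisk m) x = partialDerivOn α g (unitDisk m) x j := by
  have h := (EuclideanSpace.proj j : Euc k →L[ℝ] ℝ).iteratedFDerivWithin_comp_left (hg x hx)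
    uniqueDiffOn_unitDisk hx le_rfl
  exact congrArg (fun A : ContinuousMultilinearMap ℝ (fun _ : Fin (∑ i, α i) => Euc m) ℝ =>
    A (multiIndexDirections α)) h

end PartialDerivatives

/-! ### Disks as neighbourhoods in a space or half space -/

section DiskGeometry

open Set Topology

/-- A smooth function on `ℝ` that equals `t ↦ √(1 - t)` near `0` and dominates it on `[0, 1]`. -/
noncomputable def sqrtBump (t : ℝ) : ℝ := 1 - Real.smoothTransition (2 - 4 * t) * (1 - √(1 - t))

theorem contDiff_sqrtBump : ContDiff ℝ ∞ sqrtBump := by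
  rw [contDiff_iff_contDiffAt]
  intro t
  rcases lt_or_ge t 1 with ht | ht
  · have h1 : ContDiffAt ℝ ∞ (fun t : ℝ => √(1 - t)) t :=
      (contDiffAt_const.sub contDiffAt_id).sqrt (by simp; linarith)
    have h2 : ContDiffAt ℝ ∞ (fun t : ℝ => Real.smoothTransition (2 - 4 * t)) t :=
      (Real.smoothTransition.contDiff.comp (contDiff_const.sub (contDiff_const.mul contDiff_id))
        ).contDiffAt
    exact contDiffAt_const.sub (h2.mul (contDiffAt_const.sub h1))
  -- The transition factor vanishes from `1 / 2` on, which hides the singularity of the root at `t =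
  -- 1`.
  · refine (contDiffAt_const (c := (1 : ℝ))).congr_of_eventuallyEq ?_
    filter_upwards [lt_mem_nhds (show (1 / 2 : ℝ) < t by linarith)] with y hy
    simp [sqrtBump, Real.smoothTransition.zero_of_nonpos (show 2 - 4 * y ≤ 0 by linarith)]

theorem sqrtBump_of_le {t : ℝ} (ht : t ≤ 1 / 4) : sqrtBump t = √(1 - t) := by
  simp [sqrtBump, Real.smoothTransition.one_of_one_le (show 1 ≤ 2 - 4 * t by linarith)]

/-- `sqrtBump t` is a convex combination of `1` and `√(1 - t) ≤ 1`. -/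
theorem sqrt_le_sqrtBump {t : ℝ} (ht : 0 ≤ t) : √(1 - t) ≤ sqrtBump t := by
  have h1 : √(1 - t) ≤ 1 := Real.sqrt_le_one.2 (by linarith)
  have h2 := Real.smoothTransition.le_one (2 - 4 * t)
  have h3 := mul_nonneg (sub_nonneg.2 h2) (sub_nonneg.2 h1)
  rw [sqrtBump]
  linarith

theorem sqrtBump_le_one {t : ℝ} (ht : 0 ≤ t) : sqrtBump t ≤ 1 := by
  have h1 : √(1 - t) ≤ 1 := Real.sqrt_le_one.2 (by linarith)
  have := mul_nonneg (Real.smoothTransition.nonneg (2 - 4 * t)) (sub_nonneg.2 h1)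
  rw [sqrtBump]
  linarith

variable {m : ℕ}

/-- The square of the distance to the `i`-th coordinate axis. -/
noncomputable def axisDistSq (i : Fin m) (u : Euc m) : ℝ := ‖u‖ ^ 2 - u i ^ 2

theorem contDiff_axisDistSq (i : Fin m) : ContDiff ℝ ∞ (axisDistSq i) :=
  (contDiff_norm_sq ℝ).sub ((EuclideanSpace.proj i : Euc m →L[ℝ] ℝ).contDiff.pow 2)

theorem axisDistSq_nonneg (i : Fin m) (u : Euc m) : 0 ≤ axisDistSq i u :=
  sub_nonneg.2 (sq_le_sq.2 (by simpa using PiLp.norm_apply_le u i))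

theorem norm_add_single_sq (i : Fin m) (u : Euc m) (c : ℝ) :
    ‖u + EuclideanSpace.single i c‖ ^ 2 = axisDistSq i u + (u i + c) ^ 2 := by
  rw [norm_add_sq_real, EuclideanSpace.inner_single_right, axisDistSq]
  simp
  ring

/-- This invariance makes a shear along the `i`-th axis, by an amount depending only on `axisDistSq
i`, invertible: its inverse is the opposite shear. -/
theorem axisDistSq_add_single (i : Fin m) (u : Euc m) (c : ℝ) :
    axisDistSq i (u + EuclideanSpace.single i c) = axisDistSq i u := by
  rw [axisDistSq, norm_add_single_sq]
  simp

theorem contDiff_euclideanSingle (i : Fin m) :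
    ContDiff ℝ ∞ (fun c : ℝ => (EuclideanSpace.single i c : Euc m)) := by
  have : (fun c : ℝ => (EuclideanSpace.single i c : Euc m)) =
      fun c => c • EuclideanSpace.single i (1 : ℝ) := by
    funext c
    ext j
    simp [PiLp.single_apply]
  rw [this]
  exact contDiff_id.smul contDiff_const

/-- A cone that is the whole space or a half space is, near its vertex, the image of the unit disk
under a diffeomorphism of the whole space. -/
theorem exists_diffeo_disk_cone {K : Set (Euc m)}
    (hK : K = univ ∨ ∃ i : Fin m, K = {x | 0 ≤ x i}) :
    ∃ S S' : Euc m → Euc m, ContDiff ℝ ∞ S ∧ ContDiff ℝ ∞ S' ∧ (∀ u, S' (S u) = u) ∧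
      (∀ y, S (S' y) = y) ∧ (∀ u ∈ unitDisk m, S u ∈ K ∧ ‖S u‖ ≤ 2) ∧
      ∀ y ∈ K, ‖y‖ ≤ 1 / 2 → S' y ∈ unitDisk m := by
  rcases hK with rfl | ⟨i, rfl⟩
  · refine ⟨id, id, contDiff_id, contDiff_id, fun _ => rfl, fun _ => rfl, fun u hu => ⟨trivial, ?_⟩,
      fun y _ hy => ?_⟩
    · have : ‖u‖ ≤ 1 := by simpa using hu
      exact this.trans one_le_two
    · simp only [id, Metric.mem_closedBall, dist_zero_right]
      linarith
  -- The disk is sheared upwards along the `i`-th axis. Its lower hemisphere `u i = -√(1 - t)` lands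
  -- in the half space because the shift dominates the root, and near the axis it is flattened onto
  -- the boundary hyperplane because there the two agree.
  · have hb : ContDiff ℝ ∞ fun u : Euc m => sqrtBump (axisDistSq i u) :=
      contDiff_sqrtBump.comp (contDiff_axisDistSq i)
    have hb' : ContDiff ℝ ∞ fun u : Euc m => -sqrtBump (axisDistSq i u) := hb.neg
    refine ⟨fun u => u + EuclideanSpace.single i (sqrtBump (axisDistSq i u)),
      fun y => y + EuclideanSpace.single i (-sqrtBump (axisDistSq i y)),
      contDiff_id.add ((contDiff_euclideanSingle i).comp hb),
      contDiff_id.add ((contDiff_euclideanSingle i).comp hb'), fun u => ?_, fun y => ?_,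
      fun u hu => ?_, fun y hy0 hy => ?_⟩
    · simp only [axisDistSq_add_single]
      ext j
      by_cases hj : j = i <;> simp [hj]
    · simp only [axisDistSq_add_single]
      ext j
      by_cases hj : j = i <;> simp [hj]
    · have hn : ‖u‖ ≤ 1 := by simpa using hu
      have ht := axisDistSq_nonneg i u
      have h1 : axisDistSq i u + u i ^ 2 ≤ 1 := by
        rw [axisDistSq, sub_add_cancel]
        exact pow_le_one₀ (norm_nonneg _) hn
      have h2 : -√(1 - axisDistSq i u) ≤ u i :=
        (abs_le.1 (Real.abs_le_sqrt (by linarith : u i ^ 2 ≤ 1 - axisDistSq i u))).1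
      have h3 := sqrt_le_sqrtBump ht
      have h4 := sqrtBump_le_one ht
      have h5 := (Real.sqrt_nonneg _).trans h3
      refine ⟨?_, ?_⟩
      · simp only [mem_ofPred_eq, PiLp.add_apply, PiLp.single_apply, if_pos]
        linarith
      · refine (norm_add_le _ _).trans ?_
        rw [PiLp.norm_single, Real.norm_eq_abs, abs_of_nonneg h5]
        linarith
    · have ht := axisDistSq_nonneg i y
      have h1 : axisDistSq i y + y i ^ 2 ≤ 1 / 4 := by
        rw [axisDistSq, sub_add_cancel]
        nlinarith [norm_nonneg y]
      have hy1 : y i ≤ 1 / 2 := by nlinarith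
      have hle : axisDistSq i y ≤ 1 / 4 := by nlinarith
      have h2 := Real.sq_sqrt (by linarith : 0 ≤ 1 - axisDistSq i y)
      have h3 : 1 / 2 ≤ √(1 - axisDistSq i y) := Real.le_sqrt_of_sq_le (by linarith)
      have h0 : 0 ≤ y i := hy0
      -- The squared norm is `1 + y i * (y i - 2 * √(1 - t))` with `t = axisDistSq i y`, and `0 ≤ y
      -- i ≤ 1 / 2 ≤ √(1 - t)`.
      have h4 : ‖y + EuclideanSpace.single i (-sqrtBump (axisDistSq i y))‖ ^ 2 ≤ 1 := by
        rw [norm_add_single_sq, sqrtBump_of_le hle]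
        nlinarith
      rw [Metric.mem_closedBall, dist_zero_right]
      exact (sq_le_one_iff₀ (norm_nonneg _)).1 h4

/-- Every point of `ℝᵐ` or of a half space has arbitrarily small neighbourhoods that are images of
the unit disk under diffeomorphisms of the whole space. -/
theorem exists_diffeo_disk {X : Set (Euc m)} (hX : X = univ ∨ ∃ i : Fin m, X = {x | 0 ≤ x i})
    {x₀ : Euc m} (hx₀ : x₀ ∈ X) {N : Set (Euc m)} (hN : N ∈ 𝓝[X] x₀) :
    ∃ G G' : Euc m → Euc m, ContDiff ℝ ∞ G ∧ ContDiff ℝ ∞ G' ∧ (∀ u, G' (G u) = u) ∧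
      (∀ u ∈ unitDisk m, G u ∈ N) ∧ ∀ᶠ y in 𝓝[X] x₀, G' y ∈ unitDisk m ∧ G (G' y) = y := by
  -- Seen from `x₀`, the set `X` is locally a cone `K`: a half space at boundary points, the whole
  -- space otherwise.
  obtain ⟨K, hK, δ, hδ, hKX⟩ : ∃ K : Set (Euc m), (K = univ ∨ ∃ i : Fin m, K = {x | 0 ≤ x i}) ∧
      ∃ δ > 0, ∀ z, ‖z‖ < δ → (x₀ + z ∈ X ↔ z ∈ K) := by
    rcases hX with rfl | ⟨i, rfl⟩
    · exact ⟨univ, Or.inl rfl, 1, one_pos, fun z _ => Iff.rfl⟩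
    · rcases (show 0 ≤ x₀ i from hx₀).eq_or_lt with h0 | h0
      · exact ⟨_, Or.inr ⟨i, rfl⟩, 1, one_pos, fun z _ => by simp [← h0]⟩
      · refine ⟨univ, Or.inl rfl, x₀ i, h0, fun z hz => ?_⟩
        have := (abs_le.1 (PiLp.norm_apply_le z i)).1
        simp only [mem_ofPred_eq, PiLp.add_apply, mem_univ, iff_true]
        linarith
  have hcone : ∀ (z : Euc m) (c : ℝ), 0 < c → (c • z ∈ K ↔ z ∈ K) := by
    intro z c hc
    rcases hK with rfl | ⟨i, rfl⟩
    · simp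
    · simp [hc]
  obtain ⟨S, S', hS, hS', hSS, hSS', hSK, hS'K⟩ := exists_diffeo_disk_cone hK
  obtain ⟨ε, hε, hεN⟩ := Metric.mem_nhdsWithin_iff.1 hN
  -- `S` maps the disk into the ball of radius `2`, so after scaling by `c` its image stays within
  -- both `δ` and `ε`. Conversely, points within `c / 2` of `x₀` rescale to norm at most `1 / 2`, as
  -- the inverse requires.
  obtain ⟨c, hc, hcδ, hcε⟩ : ∃ c : ℝ, 0 < c ∧ c * 2 < δ ∧ c * 2 < ε :=
    ⟨min δ ε / 4, by positivity, by linarith [min_le_left δ ε], by linarith [min_le_right δ ε]⟩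
  refine ⟨fun u => x₀ + c • S u, fun y => S' (c⁻¹ • (y - x₀)),
    contDiff_const.add (hS.const_smul c),
    hS'.comp ((contDiff_id.sub contDiff_const).const_smul c⁻¹), fun u => ?_, fun u hu => ?_, ?_⟩
  · simp [smul_smul, inv_mul_cancel₀ hc.ne', hSS]
  · obtain ⟨h1, h2⟩ := hSK u hu
    have h3 : ‖c • S u‖ ≤ c * 2 := by
      rw [norm_smul, Real.norm_of_nonneg hc.le]
      gcongr
    refine hεN ⟨?_, (hKX _ (h3.trans_lt hcδ)).2 ((hcone _ _ hc).2 h1)⟩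
    simpa using h3.trans_lt hcε
  · filter_upwards [self_mem_nhdsWithin, mem_nhdsWithin_of_mem_nhds (Metric.ball_mem_nhds x₀ (half_pos hc))]
      with y hyX hy
    rw [Metric.mem_ball, dist_eq_norm] at hy
    refine ⟨hS'K _ ?_ ?_, ?_⟩
    · refine (hcone _ _ (inv_pos.2 hc)).2 ((hKX _ (by linarith)).1 ?_)
      simpa using hyX
    · rw [norm_smul, norm_inv, Real.norm_of_nonneg hc.le, inv_mul_le_iff₀ hc]
      linarith
    · simp [hSS', smul_smul, mul_inv_cancel₀ hc.ne']

end DiskGeometry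

/-! ### Embedded disks around the points of the manifold -/

section DiskCharts

open Set Topology

variable {m : ℕ} {H : Type*} [TopologicalSpace H] {I : ModelWithCorners ℝ (Euc m) H}
  {M : Type*} [TopologicalSpace M] [ChartedSpace H M]

/-- The chain rule for `R ∘ Q = id` makes the differential of `Q` injective, where unique
differentiability identifies the derivative of the identity within `D`. A continuous injection of a
compact space into a Hausdorff space is an embedding. -/
theorem IsEmbeddingOn.of_leftInverse [T2Space M] {Q : Euc m → M} {R : M → Euc m} {D : Set (Euc m)}
    {V : Set M} (hD : IsCompact D) (hu : UniqueDiffOn ℝ D) (hQ : ContMDiffOn 𝓘(ℝ, Euc m) I ∞ Q D)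
    (hV : IsOpen V) (hR : ContMDiffOn I 𝓘(ℝ, Euc m) ∞ R V) (hQV : ∀ u ∈ D, Q u ∈ V)
    (hRQ : ∀ u ∈ D, R (Q u) = u) : IsEmbeddingOn I Q D where
  contMDiffOn := hQ
  injective_mfderivWithin u hu' := by
    have h1 := ((hQ u hu').mdifferentiableWithinAt (by simp)).hasMFDerivWithinAt
    have h2 := ((hR.contMDiffAt (hV.mem_nhds (hQV u hu'))).mdifferentiableAt
      (by simp)).hasMFDerivAt
    let A : Euc m →L[ℝ] Euc m := (mfderiv I 𝓘(ℝ, Euc m) R (Q u)).comp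
      (mfderivWithin 𝓘(ℝ, Euc m) I Q D u)
    have h3 : HasFDerivWithinAt (R ∘ Q) A D u := (h2.comp_hasMFDerivWithinAt u h1).hasFDerivWithinAt
    have h4 : HasFDerivWithinAt (R ∘ Q) (ContinuousLinearMap.id ℝ (Euc m)) D u :=
      (hasFDerivWithinAt_id u D).congr (fun v hv => hRQ v hv) (hRQ u hu')
    have h5 := (hu u hu').eq h3 h4
    intro a b hab
    have h6 : ∀ a, mfderiv I 𝓘(ℝ, Euc m) R (Q u) (mfderivWithin 𝓘(ℝ, Euc m) I Q D u a) = a :=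
      fun a => congrArg (fun L : Euc m →L[ℝ] Euc m => L a) h5
    rw [← h6 a, ← h6 b, hab]
  isEmbedding := by
    have : CompactSpace D := isCompact_iff_compactSpace.1 hD
    refine (Continuous.isClosedEmbedding (continuousOn_iff_continuous_domRestrict.1 hQ.continuousOn)
      fun a b hab => Subtype.ext ?_).isEmbedding
    rw [← hRQ a a.2, ← hRQ b b.2]
    exact congrArg R hab

/-- The inverse chart is precomposed with a diffeomorphism taking the disk to a neighbourhood inside
the chart target. The left inverse `R` maps `V` into the closed disk, even at boundary points of
`M`, so derivatives can be transferred to the disk. -/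
theorem exists_diskChart [IsManifold I ∞ M] [T2Space M] (hI : IsBoundaryModel I) (p : M) :
    ∃ (Q : Euc m → M) (R : M → Euc m) (V : Set M), IsEmbeddingOn I Q (unitDisk m) ∧ V ∈ 𝓝 p ∧
      ContMDiffOn I 𝓘(ℝ, Euc m) ∞ R V ∧ ∀ z ∈ V, R z ∈ unitDisk m ∧ Q (R z) = z := by
  obtain ⟨G, G', hG, hG', hGG, hGN, hev⟩ := exists_diffeo_disk hI
    (mem_range_self (chartAt H p p) : extChartAt I p p ∈ range I)
    (extChartAt_target_mem_nhdsWithin (I := I) p)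
  have hQ : ContMDiffOn 𝓘(ℝ, Euc m) I ∞ ((extChartAt I p).symm ∘ G) (unitDisk m) :=
    (contMDiffOn_extChartAt_symm p).comp hG.contMDiff.contMDiffOn hGN
  have hR : ContMDiffOn I 𝓘(ℝ, Euc m) ∞ (G' ∘ extChartAt I p) (extChartAt I p).source :=
    hG'.contMDiff.comp_contMDiffOn (by rw [extChartAt_source]; exact contMDiffOn_extChartAt)
  have hsrc := extChartAt_source_mem_nhds (I := I) p
  have hev : ∀ᶠ y in 𝓝[range I] extChartAt I p p, G' y ∈ unitDisk m ∧ G (G' y) = y := hev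
  rw [← map_extChartAt_nhds, Filter.eventually_map] at hev
  exact ⟨(extChartAt I p).symm ∘ G, G' ∘ extChartAt I p, _,
    .of_leftInverse (isCompact_closedBall _ _) uniqueDiffOn_unitDisk hQ
      (isOpen_extChartAt_source p) hR
      (fun u hu => (extChartAt I p).map_target (hGN u hu))
      (fun u hu => (congrArg G' ((extChartAt I p).right_inv (hGN u hu))).trans (hGG u)),
    Filter.inter_mem hsrc hev, hR.mono inter_subset_left, fun z hz => ⟨hz.2.1,
      (congrArg (extChartAt I p).symm hz.2.2).trans ((extChartAt I p).left_inv hz.1)⟩⟩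

end DiskCharts

/-! ### Reduction of the seminorms to finitely many disks -/

section WeakTopology

open Topology

universe u

variable {m : ℕ} {H : Type*} [TopologicalSpace H] {I : ModelWithCorners ℝ (Euc m) H}
  {M : Type u} [TopologicalSpace M] [ChartedSpace H M] {r : ℕ∞} {k : ℕ}

instance : IsTopologicalAddGroup (CrMap I M r k) :=
  topologicalAddGroup_iInf fun _ => topologicalAddGroup_iInf fun _ => inferInstance

theorem withSeminorms_weakSeminorm :
    WithSeminorms fun a : CompactEmbedding I M × {s : ℕ // (s : ℕ∞) ≤ r} =>
      weakSeminorm (k := k) a.1 a.2.1 a.2.2 := by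
  rw [SeminormFamily.withSeminorms_iff_topologicalSpace_eq_iInf, iInf_prod]
  rfl

theorem norm_partialDerivOn_le_weakSeminorm (P : CompactEmbedding I M) {s : ℕ}
    (hs : (s : ℕ∞) ≤ r) (f : CrMap I M r k) {α : Fin m → ℕ} (hα : ∑ i, α i ≤ s) {x : Euc m}
    (hx : x ∈ interior P.domain) :
    ‖partialDerivOn α (f ∘ P.toFun) P.domain x‖ ≤ weakSeminorm P s hs f :=
  le_ciSup (P.bddAbove hs f) (⟨⟨α, hα⟩, ⟨x, hx⟩⟩ : P.Range s)

theorem weakSeminorm_le (P : CompactEmbedding I M) {s : ℕ} (hs : (s : ℕ∞) ≤ r)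
    (f : CrMap I M r k) {C : ℝ} (hC : 0 ≤ C) (h : ∀ α : Fin m → ℕ, ∑ i, α i ≤ s →
      ∀ x ∈ interior P.domain, ‖partialDerivOn α (f ∘ P.toFun) P.domain x‖ ≤ C) :
    weakSeminorm P s hs f ≤ C :=
  Real.iSup_le (fun a => h a.1.1 a.1.2 a.2 a.2.2) hC

variable (I M) in
/-- The embeddings of the unit disk in `M`. -/
abbrev DiskEmbedding : Type _ := {Q : Euc m → M // IsEmbeddingOn I Q (unitDisk m)}

/-- The embedding of the unit disk, as an embedding of a compact set. -/
def DiskEmbedding.toCompactEmbedding (Q : DiskEmbedding I M) : CompactEmbedding I M :=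
  ⟨unitDisk m, Q.1, isCompact_closedBall _ _, Q.2⟩

theorem DiskEmbedding.contDiffOn_comp (Q : DiskEmbedding I M) (f : CrMap I M r k) {n : ℕ}
    (hn : (n : ℕ∞) ≤ r) : ContDiffOn ℝ n (f ∘ Q.1) (unitDisk m) :=
  (Q.toCompactEmbedding.contDiffOn_comp f).of_le (by exact_mod_cast hn)

/-- The supremum over the interior also bounds the boundary values, by continuity. Thus the seminorm
controls a sup norm on the closed disk. -/
theorem DiskEmbedding.norm_partialDerivOn_le (Q : DiskEmbedding I M) {s : ℕ}
    (hs : (s : ℕ∞) ≤ r) (f : CrMap I M r k) {α : Fin m → ℕ} (hα : ∑ i, α i ≤ s) {x : Euc m}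
    (hx : x ∈ unitDisk m) :
    ‖partialDerivOn α (f ∘ Q.1) (unitDisk m) x‖ ≤ weakSeminorm Q.toCompactEmbedding s hs f :=
  norm_le_on_unitDisk
    (continuousOn_partialDerivOn (Q.contDiffOn_comp f ((Nat.cast_le.2 hα).trans hs)))
    (fun _ hy => norm_partialDerivOn_le_weakSeminorm Q.toCompactEmbedding hs f hα hy) x hx

theorem DiskEmbedding.norm_iteratedFDerivWithin_le (Q : DiskEmbedding I M) {s n : ℕ}
    (hs : (s : ℕ∞) ≤ r) (hn : n ≤ s) (f : CrMap I M r k) {x : Euc m} (hx : x ∈ unitDisk m) :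
    ‖iteratedFDerivWithin ℝ n (f ∘ Q.1) (unitDisk m) x‖ ≤
      m ^ n * weakSeminorm Q.toCompactEmbedding s hs f :=
  norm_iteratedFDerivWithin_unitDisk_le hn (Q.contDiffOn_comp f hs) (apply_nonneg _ _)
    (fun _ hα _ hy => Q.norm_partialDerivOn_le hs f hα (interior_subset hy)) x hx

/-- Near each point, the seminorm of an embedding is bounded by that of a disk. -/
theorem CompactEmbedding.exists_local_bound [IsManifold I ∞ M] [T2Space M] (hI : IsBoundaryModel I)
    (P : CompactEmbedding I M) {s : ℕ} (hs : (s : ℕ∞) ≤ r) {x : Euc m} (hx : x ∈ P.domain) :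
    ∃ W ∈ 𝓝 x, ∃ (Q : DiskEmbedding I M) (C : ℝ), 0 ≤ C ∧ ∀ f : CrMap I M r k,
      ∀ y ∈ W ∩ interior P.domain, ∀ α : Fin m → ℕ, ∑ i, α i ≤ s →
        ‖partialDerivOn α (f ∘ P.toFun) P.domain y‖ ≤
          C * weakSeminorm Q.toCompactEmbedding s hs f := by
  obtain ⟨Q, R, V, hQ, hV, hR, hRQ⟩ := exists_diskChart hI (P.toFun x)
  have hPV : P.toFun ⁻¹' V ∈ 𝓝[P.domain] x :=
    (P.isEmbeddingOn.contMDiffOn.continuousOn x hx).preimage_mem_nhdsWithin'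
      (nhdsWithin_le_nhds hV)
  obtain ⟨ε, hε, hεV⟩ := Metric.mem_nhdsWithin_iff.1 hPV
  -- On this compact piece `P` stays in `V`, so `f ∘ P = (f ∘ Q) ∘ h`, where `h` does not depend on
  -- `f` and has bounded derivatives. Values of `h` on the boundary sphere do no harm, as the bounds
  -- for `f ∘ Q` hold there too.
  set D : Set (Euc m) := P.domain ∩ Metric.closedBall x (ε / 2)
  have hDV : ∀ y ∈ D, P.toFun y ∈ V := fun y hy =>
    hεV ⟨Metric.closedBall_subset_ball (half_lt_self hε) hy.2, hy.1⟩
  have hD : IsCompact D := P.isCompact_domain.inter_right Metric.isClosed_closedBall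
  set h : Euc m → Euc m := R ∘ P.toFun
  have hh : ContDiffOn ℝ s h D := by
    rw [← contMDiffOn_iff_contDiffOn]
    exact (hR.comp (P.isEmbeddingOn.contMDiffOn.mono Set.inter_subset_left) hDV).of_le
      (by exact_mod_cast (le_top : (s : ℕ∞) ≤ ⊤))
  -- `B ≥ 1` gives `B ≤ B ^ i` for `i ≥ 1`, the form in which the composition estimate wants its
  -- bounds; likewise `m + 1` replaces `m` to make powers monotone.
  obtain ⟨B, hB1, hB⟩ : ∃ B : ℝ, 1 ≤ B ∧ ∀ n ≤ s, ∀ y ∈ interior D,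
      ‖iteratedFDerivWithin ℝ n h D y‖ ≤ B := by
    have hex : ∀ n : ℕ, ∃ C : ℝ, n ≤ s → ∀ y ∈ interior D,
        ‖iteratedFDerivWithin ℝ n h D y‖ ≤ C := fun n => by
      by_cases hn : n ≤ s
      · obtain ⟨C, hC⟩ := exists_bound_iteratedFDerivWithin hD hh hn
        exact ⟨C, fun _ => hC⟩
      · exact ⟨0, fun h => absurd h hn⟩
    choose C hC using hex
    refine ⟨1 + ∑ n ∈ Finset.range (s + 1), |C n|,
      le_add_of_nonneg_right (Finset.sum_nonneg fun _ _ => abs_nonneg _), fun n hn y hy => ?_⟩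
    have h1 := Finset.single_le_sum (f := fun n => |C n|) (fun _ _ => abs_nonneg _)
      (Finset.mem_range.2 (Nat.lt_succ_of_le hn))
    linarith [hC n hn y hy, le_abs_self (C n)]
  refine ⟨Metric.ball x (ε / 2), Metric.ball_mem_nhds x (half_pos hε), ⟨Q, hQ⟩,
    s.factorial * (m + 1) ^ s * B ^ s, by positivity, fun f y hy α hα => ?_⟩
  set N := weakSeminorm (DiskEmbedding.toCompactEmbedding ⟨Q, hQ⟩) s hs f
  have hN : 0 ≤ N := apply_nonneg _ _
  have hyD : y ∈ interior D := by
    refine interior_mono ?_ (?_ : y ∈ interior (Metric.ball x (ε / 2) ∩ interior P.domain))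
    · exact fun z hz => ⟨interior_subset hz.2, Metric.ball_subset_closedBall hz.1⟩
    · rwa [(Metric.isOpen_ball.inter isOpen_interior).interior_eq]
  have hset : ∀ {S : Set (Euc m)}, interior D ⊆ S → S =ᶠ[𝓝 y] interior D := fun hS => by
    filter_upwards [isOpen_interior.mem_nhds hyD] with z hz
    exact propext ⟨fun _ => hz, fun _ => hS hz⟩
  set n := ∑ i, α i
  have hcomp : iteratedFDerivWithin ℝ n (f ∘ P.toFun) P.domain y =
      iteratedFDerivWithin ℝ n ((f ∘ Q) ∘ h) (interior D) y := by
    rw [iteratedFDerivWithin_congr_set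
      (hset (interior_subset.trans Set.inter_subset_left)) n]
    refine iteratedFDerivWithin_congr (fun z hz => ?_) hyD n
    simp [h, (hRQ _ (hDV z (interior_subset hz))).2]
  have h1 : (1 : ℝ) ≤ m + 1 := le_add_of_nonneg_left (Nat.cast_nonneg m)
  calc ‖partialDerivOn α (f ∘ P.toFun) P.domain y‖
      ≤ ‖iteratedFDerivWithin ℝ n ((f ∘ Q) ∘ h) (interior D) y‖ :=
        hcomp ▸ norm_partialDerivOn_le _ _ _ _
    _ ≤ n.factorial * ((m + 1) ^ s * N) * B ^ n := by
      refine norm_iteratedFDerivWithin_comp_le (N := s)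
        (DiskEmbedding.contDiffOn_comp ⟨Q, hQ⟩ f hs) (hh.mono interior_subset)
        (by exact_mod_cast hα) uniqueDiffOn_unitDisk isOpen_interior.uniqueDiffOn
        (fun z hz => (hRQ _ (hDV z (interior_subset hz))).1) hyD (fun i hi => ?_)
        fun i hi hin => ?_
      · refine (DiskEmbedding.norm_iteratedFDerivWithin_le ⟨Q, hQ⟩ hs (hi.trans hα) f
          (hRQ _ (hDV y (interior_subset hyD))).1).trans ?_
        refine mul_le_mul_of_nonneg_right ?_ hN
        exact (pow_le_pow_left₀ (Nat.cast_nonneg m) (by linarith) i).trans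
          (pow_le_pow_right₀ h1 (hi.trans hα))
      · rw [← iteratedFDerivWithin_congr_set (hset interior_subset) i]
        exact (hB i (hin.trans hα) y hyD).trans (le_self_pow₀ hB1 (by omega))
    _ ≤ s.factorial * ((m + 1) ^ s * N) * B ^ s := by
      gcongr
    _ = s.factorial * (m + 1) ^ s * B ^ s * N := by ring

/-- The seminorm of an embedding is bounded by those of finitely many disks. -/
theorem CompactEmbedding.exists_weakSeminorm_le [IsManifold I ∞ M] [T2Space M]
    (hI : IsBoundaryModel I) (P : CompactEmbedding I M) {s : ℕ} (hs : (s : ℕ∞) ≤ r) :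
    ∃ (L : Finset (DiskEmbedding I M)) (C : ℝ), 0 ≤ C ∧ ∀ f : CrMap I M r k,
      weakSeminorm P s hs f ≤ C * ∑ Q ∈ L, weakSeminorm Q.toCompactEmbedding s hs f := by
  classical
  have key : ∃ (L : Finset (DiskEmbedding I M)) (C : ℝ), 0 ≤ C ∧ ∀ f : CrMap I M r k,
      ∀ y ∈ P.domain ∩ interior P.domain, ∀ α : Fin m → ℕ, ∑ i, α i ≤ s →
        ‖partialDerivOn α (f ∘ P.toFun) P.domain y‖ ≤
          C * ∑ Q ∈ L, weakSeminorm Q.toCompactEmbedding s hs f := by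
    refine P.isCompact_domain.induction_on
      (p := fun S => ∃ (L : Finset (DiskEmbedding I M)) (C : ℝ), 0 ≤ C ∧ ∀ f : CrMap I M r k,
        ∀ y ∈ S ∩ interior P.domain, ∀ α : Fin m → ℕ, ∑ i, α i ≤ s →
        ‖partialDerivOn α (f ∘ P.toFun) P.domain y‖ ≤
          C * ∑ Q ∈ L, weakSeminorm Q.toCompactEmbedding s hs f)
      ⟨∅, 0, le_rfl, by simp⟩ ?_ ?_ ?_
    · rintro S T hST ⟨L, C, hC, h⟩
      exact ⟨L, C, hC, fun f y hy => h f y ⟨hST hy.1, hy.2⟩⟩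
    · rintro S T ⟨L, C, hC, h⟩ ⟨L', C', hC', h'⟩
      have hmono : ∀ {L₁ L₂ : Finset (DiskEmbedding I M)} (f : CrMap I M r k), L₁ ⊆ L₂ →
          ∑ Q ∈ L₁, weakSeminorm Q.toCompactEmbedding s hs f ≤
            ∑ Q ∈ L₂, weakSeminorm Q.toCompactEmbedding s hs f := fun f hL =>
        Finset.sum_le_sum_of_subset_of_nonneg hL fun _ _ _ => apply_nonneg _ _
      have hnn : ∀ (L : Finset (DiskEmbedding I M)) (f : CrMap I M r k),
          0 ≤ ∑ Q ∈ L, weakSeminorm Q.toCompactEmbedding s hs f := fun L f =>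
        Finset.sum_nonneg fun _ _ => apply_nonneg _ _
      refine ⟨L ∪ L', C + C', add_nonneg hC hC', fun f y hy α hα => ?_⟩
      rcases hy with ⟨hy | hy, hy'⟩
      · exact (h f y ⟨hy, hy'⟩ α hα).trans (mul_le_mul (le_add_of_nonneg_right hC')
          (hmono f Finset.subset_union_left) (hnn L f) (add_nonneg hC hC'))
      · exact (h' f y ⟨hy, hy'⟩ α hα).trans (mul_le_mul (le_add_of_nonneg_left hC)
          (hmono f Finset.subset_union_right) (hnn L' f) (add_nonneg hC hC'))
    · intro x hx
      obtain ⟨W, hW, Q, C, hC, h⟩ := P.exists_local_bound (k := k) hI hs hx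
      exact ⟨W, mem_nhdsWithin_of_mem_nhds hW, {Q}, C, hC, by simpa using h⟩
  obtain ⟨L, C, hC, h⟩ := key
  exact ⟨L, C, hC, fun f => weakSeminorm_le P hs f
    (mul_nonneg hC (Finset.sum_nonneg fun _ _ => apply_nonneg _ _))
    fun α hα x hx => h f x ⟨interior_subset hx, hx⟩ α hα⟩

/-- A continuous functional is bounded by the seminorms of finitely many disks. -/
theorem exists_bound_of_crDual [IsManifold I ∞ M] [T2Space M] (hI : IsBoundaryModel I)
    (T : CrDual I M r k) :
    ∃ (ι : Type u) (_ : Fintype ι) (Q : ι → DiskEmbedding I M) (s : ι → ℕ)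
      (hs : ∀ i, (s i : ℕ∞) ≤ r) (C : ℝ), 0 ≤ C ∧ ∀ f : CrMap I M r k,
      ‖T f‖ ≤ C * ∑ i, weakSeminorm (Q i).toCompactEmbedding (s i) (hs i) f := by
  obtain ⟨A, C, -, hC⟩ := Seminorm.bound_of_continuous withSeminorms_weakSeminorm
    ((normSeminorm ℝ ℝ).comp T.toLinearMap) (by exact continuous_norm.comp T.continuous)
  choose L B hB h using fun a : CompactEmbedding I M × {s : ℕ // (s : ℕ∞) ≤ r} =>
    a.1.exists_weakSeminorm_le (k := k) hI a.2.2
  -- Each disk is indexed together with the seminorm it came from, since the order `s` depends on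
  -- that seminorm.
  refine ⟨Σ a : A, L a, inferInstance, fun i => i.2.1, fun i => i.1.1.2.1, fun i => i.1.1.2.2,
    C * ∑ a ∈ A, B a, mul_nonneg C.2 (Finset.sum_nonneg fun a _ => hB a), fun f => ?_⟩
  set p := fun a : CompactEmbedding I M × {s : ℕ // (s : ℕ∞) ≤ r} =>
    weakSeminorm (k := k) a.1 a.2.1 a.2.2
  have h1 : ‖T f‖ ≤ C * A.sup p f := hC f
  have h2 : A.sup p f ≤ ∑ a ∈ A, p a f := by
    refine (Seminorm.finset_sup_le_sum p A f).trans_eq ?_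
    change FunLike.coeAddMonoidHom (Seminorm ℝ (CrMap I M r k)) _ _ (∑ a ∈ A, p a) f = _
    rw [map_sum, Finset.sum_apply]
    rfl
  refine h1.trans ?_
  rw [mul_assoc]
  refine mul_le_mul_of_nonneg_left (h2.trans ?_) C.2
  have hnn : ∀ a, 0 ≤ ∑ Q ∈ L a, weakSeminorm Q.toCompactEmbedding a.2.1 a.2.2 f := fun a =>
    Finset.sum_nonneg fun _ _ => apply_nonneg _ _
  have h3 : ∑ i : (Σ a : A, L a), weakSeminorm i.2.1.toCompactEmbedding i.1.1.2.1 i.1.1.2.2 f =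
      ∑ a ∈ A, ∑ Q ∈ L a, weakSeminorm Q.toCompactEmbedding a.2.1 a.2.2 f := by
    rw [Fintype.sum_sigma, ← Finset.sum_coe_sort A]
    exact Finset.sum_congr rfl fun a _ => Finset.sum_coe_sort (L a)
      fun Q => weakSeminorm Q.toCompactEmbedding a.1.2.1 a.1.2.2 f
  rw [h3, Finset.mul_sum]
  exact Finset.sum_le_sum fun a ha => (h a f).trans (mul_le_mul_of_nonneg_right
    (Finset.single_le_sum (fun a _ => hB a) ha) (hnn a))

end WeakTopology

/-! ### Local functionals, their span, and point evaluations -/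

section LocalFunctionals

open Topology

variable {m : ℕ} {H : Type*} [TopologicalSpace H] {I : ModelWithCorners ℝ (Euc m) H}
  {M : Type*} [TopologicalSpace M] [ChartedSpace H M] {r : ℕ∞} {k : ℕ}

theorem DiskEmbedding.contDiffOn_comp_coord (Q : DiskEmbedding I M) {n : ℕ} (hn : (n : ℕ∞) ≤ r)
    (j : Fin k) (f : CrMap I M r k) :
    ContDiffOn ℝ n (fun x => f (Q.1 x) j) (unitDisk m) :=
  (EuclideanSpace.proj j : Euc k →L[ℝ] ℝ).contDiff.comp_contDiffOn (Q.contDiffOn_comp f hn)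

/-- The operator `f ↦ ∂_α (fʲ ∘ Q)` with values in the continuous functions on the disk. -/
noncomputable def DiskEmbedding.partialDeriv (Q : DiskEmbedding I M) {α : Fin m → ℕ}
    (hα : ((∑ i, α i : ℕ) : ℕ∞) ≤ r) (j : Fin k) : CrMap I M r k →ₗ[ℝ] C(unitDisk m, ℝ) where
  toFun f := ⟨fun u => partialDerivOn α (fun x => f (Q.1 x) j) (unitDisk m) u,
    (continuousOn_partialDerivOn (Q.contDiffOn_comp_coord hα j f)).domRestrict⟩
  map_add' f g := ContinuousMap.ext fun u =>
    congrArg (fun A : ContinuousMultilinearMap ℝ (fun _ : Fin (∑ i, α i) => Euc m) ℝ =>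
      A (multiIndexDirections α)) (iteratedFDerivWithin_add_apply
        (Q.contDiffOn_comp_coord hα j f u u.2) (Q.contDiffOn_comp_coord hα j g u u.2)
        uniqueDiffOn_unitDisk u.2)
  map_smul' _ f := ContinuousMap.ext fun u =>
    congrArg (fun A : ContinuousMultilinearMap ℝ (fun _ : Fin (∑ i, α i) => Euc m) ℝ =>
      A (multiIndexDirections α)) (iteratedFDerivWithin_const_smul_apply
        (Q.contDiffOn_comp_coord hα j f u u.2) uniqueDiffOn_unitDisk u.2)

theorem DiskEmbedding.partialDeriv_apply (Q : DiskEmbedding I M) {α : Fin m → ℕ}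
    (hα : ((∑ i, α i : ℕ) : ℕ∞) ≤ r) (j : Fin k) (f : CrMap I M r k) (u : unitDisk m) :
    Q.partialDeriv hα j f u = partialDerivOn α (f ∘ Q.1) (unitDisk m) u j :=
  partialDerivOn_coord (Q.contDiffOn_comp f hα) u.2 j

theorem DiskEmbedding.norm_partialDeriv_le (Q : DiskEmbedding I M) {α : Fin m → ℕ}
    (hα : ((∑ i, α i : ℕ) : ℕ∞) ≤ r) (j : Fin k) (f : CrMap I M r k) :
    ‖Q.partialDeriv hα j f‖ ≤ weakSeminorm Q.toCompactEmbedding (∑ i, α i) hα f := by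
  refine (ContinuousMap.norm_le _ (apply_nonneg _ _)).2 fun u => ?_
  rw [Q.partialDeriv_apply]
  exact (PiLp.norm_apply_le _ j).trans (Q.norm_partialDerivOn_le hα f le_rfl u.2)

/-- A continuous functional on the continuous functions on the disk, composed with `∂_α (fʲ ∘ Q)`. -/
noncomputable def DiskEmbedding.functional (Q : DiskEmbedding I M) {α : Fin m → ℕ}
    (hα : ((∑ i, α i : ℕ) : ℕ∞) ≤ r) (j : Fin k) (l : C(unitDisk m, ℝ) →L[ℝ] ℝ) :
    CrDual I M r k where
  toLinearMap := l.toLinearMap ∘ₗ Q.partialDeriv hα j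
  cont := by
    refine WithSeminorms.continuous_of_isBounded withSeminorms_weakSeminorm (norm_withSeminorms ℝ ℝ) _
      fun _ => ⟨{(Q.toCompactEmbedding, ⟨∑ i, α i, hα⟩)}, ‖l‖₊, fun f => ?_⟩
    rw [Finset.sup_singleton]
    exact (l.le_opNorm _).trans (mul_le_mul_of_nonneg_left (Q.norm_partialDeriv_le hα j f)
      (norm_nonneg l))

theorem DiskEmbedding.functional_apply (Q : DiskEmbedding I M) {α : Fin m → ℕ}
    (hα : ((∑ i, α i : ℕ) : ℕ∞) ≤ r) (j : Fin k) (l : C(unitDisk m, ℝ) →L[ℝ] ℝ)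
    (f : CrMap I M r k) : Q.functional hα j l f = l (Q.partialDeriv hα j f) :=
  rfl

theorem DiskEmbedding.functional_mem_localFunctionals (Q : DiskEmbedding I M) {α : Fin m → ℕ}
    (hα : ((∑ i, α i : ℕ) : ℕ∞) ≤ r) (j : Fin k) (l : C(unitDisk m, ℝ) →L[ℝ] ℝ) :
    Q.functional hα j l ∈ localFunctionals I M r k := by
  obtain ⟨μ, hμ⟩ := exists_signedMeasure_integral_eq l
  exact ⟨Q.1, α, j, μ, Q.2, hα, fun f => hμ _⟩

instance finite_multiIndex (s : ℕ) : Finite {α : Fin m → ℕ // ∑ i, α i ≤ s} :=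
  (Set.finite_Iic fun _ : Fin m => s).subset fun _ hα i =>
    (Finset.single_le_sum (fun _ _ => Nat.zero_le _) (Finset.mem_univ i)).trans hα

theorem EuclideanSpace.norm_le_sum {n : ℕ} (v : Euc n) : ‖v‖ ≤ ∑ j, ‖v j‖ := by
  have hv : v = ∑ j, EuclideanSpace.single j (v j) := by
    ext i
    simp
  conv_lhs => rw [hv]
  exact (norm_sum_le _ _).trans (by simp)

/-- Turns a disk seminorm into finitely many norms of linear maps into one Banach space `C(𝔻ᵐ)`, the
kind of bound from which a functional can be factored. -/
theorem DiskEmbedding.weakSeminorm_le_sum (Q : DiskEmbedding I M) {s : ℕ} (hs : (s : ℕ∞) ≤ r)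
    [Fintype {α : Fin m → ℕ // ∑ i, α i ≤ s}] (f : CrMap I M r k) :
    weakSeminorm Q.toCompactEmbedding s hs f ≤
      ∑ a : {α : Fin m → ℕ // ∑ i, α i ≤ s} × Fin k,
        ‖Q.partialDeriv ((Nat.cast_le.2 a.1.2).trans hs) a.2 f‖ := by
  refine weakSeminorm_le _ hs f (Finset.sum_nonneg fun _ _ => norm_nonneg _) fun α hα x hx => ?_
  rw [Fintype.sum_prod_type]
  refine le_trans ?_ (Finset.single_le_sum (f := fun a : {α : Fin m → ℕ // ∑ i, α i ≤ s} =>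
    ∑ j, ‖Q.partialDeriv ((Nat.cast_le.2 a.2).trans hs) j f‖)
    (fun _ _ => Finset.sum_nonneg fun _ _ => norm_nonneg _) (Finset.mem_univ ⟨α, hα⟩))
  refine (EuclideanSpace.norm_le_sum _).trans (Finset.sum_le_sum fun j _ => ?_)
  have h := (Q.partialDeriv ((Nat.cast_le.2 hα).trans hs) j f).norm_coe_le_norm
    ⟨x, interior_subset hx⟩
  rwa [Q.partialDeriv_apply] at h

/-- Every continuous functional on `𝒞ʳ(M, ℝᵏ)` is a sum of local ones. -/
theorem span_localFunctionals_eq_top [IsManifold I ∞ M] [T2Space M] (hI : IsBoundaryModel I) :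
    Submodule.span ℝ (localFunctionals I M r k) = ⊤ := by
  rw [Submodule.eq_top_iff']
  intro T
  obtain ⟨ι, _, Q, s, hs, C, hC, hT⟩ := exists_bound_of_crDual hI T
  let _ : ∀ s, Fintype {α : Fin m → ℕ // ∑ i, α i ≤ s} := fun s => Fintype.ofFinite _
  -- One operator for each choice of disk, multi-index and component; `T` is bounded by the sum of
  -- their norms.
  let J : (Σ i, {α : Fin m → ℕ // ∑ l, α l ≤ s i} × Fin k) → CrMap I M r k →ₗ[ℝ] C(unitDisk m, ℝ) :=
    fun a => (Q a.1).partialDeriv ((Nat.cast_le.2 a.2.1.2).trans (hs a.1)) a.2.2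
  obtain ⟨l, hl⟩ := exists_eq_sum_comp_of_le J T.toLinearMap (C := C) fun f => by
    rw [Fintype.sum_sigma]
    exact (hT f).trans (mul_le_mul_of_nonneg_left
      (Finset.sum_le_sum fun i _ => (Q i).weakSeminorm_le_sum (hs i) f) hC)
  let φ : (Σ i, {α : Fin m → ℕ // ∑ l, α l ≤ s i} × Fin k) → CrDual I M r k := fun a =>
    (Q a.1).functional ((Nat.cast_le.2 a.2.1.2).trans (hs a.1)) a.2.2 (l a)
  have hTl : T = ∑ a, φ a := by
    refine ContinuousLinearMap.ext fun f => (hl f).trans ?_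
    let ev : CrDual I M r k →+ ℝ :=
      { toFun := fun φ => φ f, map_zero' := rfl, map_add' := fun _ _ => rfl }
    exact (map_sum ev φ Finset.univ).symm
  rw [hTl]
  exact Submodule.sum_mem _ fun a _ => Submodule.subset_span
    ((Q a.1).functional_mem_localFunctionals _ _ _)

theorem partialDerivOn_zero {F : Type*} [NormedAddCommGroup F] [NormedSpace ℝ F]
    (g : Euc m → F) (D : Set (Euc m)) (x : Euc m) : partialDerivOn 0 g D x = g x := by
  -- The order `∑ i, 0` is zero only propositionally, so the order is generalized before it is
  -- substituted.
  have h : ∀ n, n = 0 → ∀ v : Fin n → Euc m, iteratedFDerivWithin ℝ n g D x v = g x := by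
    rintro _ rfl v
    exact iteratedFDerivWithin_zero_apply v
  exact h _ (by simp) _

/-- The Dirac functional at `R p` on an embedded disk through `p`, with the zero multi-index;
continuity is inherited from the local functionals. -/
theorem exists_pointEvaluation [IsManifold I ∞ M] [T2Space M] (hI : IsBoundaryModel I) (p : M)
    (j : Fin k) : ∃ δ : CrDual I M r k, ∀ f : CrMap I M r k, δ f = f p j := by
  obtain ⟨Q, R, V, hQ, hV, -, hRQ⟩ := exists_diskChart hI p
  obtain ⟨h1, h2⟩ := hRQ p (mem_of_mem_nhds hV)
  refine ⟨DiskEmbedding.functional ⟨Q, hQ⟩ (α := 0) (by simp) j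
    (ContinuousMap.evalCLM ℝ ⟨R p, h1⟩), fun f => ?_⟩
  rw [DiskEmbedding.functional_apply, ContinuousMap.evalCLM_apply, DiskEmbedding.partialDeriv_apply,
    partialDerivOn_zero, Function.comp_apply]
  exact congrArg (fun q => f q j) h2

end LocalFunctionals

theorem mainTheorem12 {m : ℕ} {H : Type*} [TopologicalSpace H]
    (I : ModelWithCorners ℝ (Euc m) H) (hI : IsBoundaryModel I)
    (M : Type*) [TopologicalSpace M] [ChartedSpace H M] [IsManifold I ∞ M]
    [T2Space M] [SecondCountableTopology M] (r : ℕ∞) (k : ℕ) :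
    Submodule.span ℝ (localFunctionals I M r k) = ⊤ ∧
    (∀ (p : M) (j : Fin k), ∃ δ : CrDual I M r k, ∀ f : CrMap I M r k, δ f = f p j) ∧
    closure (Submodule.span ℝ (pointEvaluations I M r k) : Set (CrDual I M r k)) = Set.univ := by
  refine ⟨span_localFunctionals_eq_top hI, exists_pointEvaluation hI,
    closure_span_eq_univ_of_separating _ fun f hf => ?_⟩
  ext p j
  obtain ⟨δ, hδ⟩ := exists_pointEvaluation (r := r) hI p j
  rw [← hδ f, hf δ ⟨p, j, hδ⟩]
  rfl
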